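/- Call a set $\Omega\subseteq\{1,\dots,p\}^2$ $d$-distributed if it contains the diagonal and has at most $d$ elements in each row and in each column; call $X\in\mathbb R^{p\times p}$ $d$-distributed sparse if its support is contained in a $d$-distributed set. The uniformly random $\delta$-left regular bipartite graph on $\{1,\dots,p\}$ (left) and $\{1,\dots,m\}$ (right) is obtained by choosing, for every left vertex $i$, right endpoints $j_{i,1},\dots,j_{i,\delta}$ independently and uniformly from $\{1,\dots,m\}$ (with replacement, independently over $i$). Its $m\times p$ adjacency matrix has $(j,i)$ entry $1$ if $\{i,j\}$ is an edge and $0$ otherwise. Theorem. For all constants $0<a\le b$ there are constants $C>0$ and $c>0$, depending only on $a$ and $b$, such that the following holds for all natural numbers $p\ge 2$, $d$, $m$, $\delta$ with $$m\ \ge\ C\sqrt{dp}\,\log p,\qquad a\log p\ \le\ \delta\ \le\ b\log p,$$ and for every fixed $d$-distributed sparse matrix $X\in\mathbb R^{p\times p}$. Let $A,B\in\{0,1\}^{m\times p}$ be the adjacency matrices of two independent uniformly random $\delta$-left regular bipartite graphs. Then, with probability exceeding $1-p^{-c}$, the program $$(\mathrm P_1)\qquad \text{minimize } \|\tilde X\|_1=\sum_{i,j}|\tilde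 X_{ij}| \quad\text{subject to}\quad A\tilde XB^T=AXB^T,\ \ \tilde X\in\mathbb R^{p\times p},$$ has $X$ as its unique optimal solution. The same holds when $B=A$ (with $A$ random as above). Both claims, with the same constants, also hold if the adjacency matrices count parallel edges with multiplicity, i.e. if the $(j,i)$ entry is $\#\{k: j_{i,k}=j\}$. (In particular, $m=\mathcal O(\sqrt{dp}\log p)$ and $\delta=\mathcal O(\log p)$ suffice.) -/

import Mathlib

open MeasureTheory

noncomputable section

namespace Sketch

/-- A set `Ω ⊆ [p] × [p]` is `d`-distributed if it contains the diagonal and has at most `d`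
elements in each row and at most `d` elements in each column. -/
def IsDistributed {p : ℕ} (d : ℕ) (Ω : Finset (Fin p × Fin p)) : Prop :=
  (∀ i, (i, i) ∈ Ω) ∧
    ∀ k, (Ω.filter fun x => x.1 = k).card ≤ d ∧ (Ω.filter fun x => x.2 = k).card ≤ d

/-- A matrix is `d`-distributed sparse if its support lies in a `d`-distributed set. -/
def IsDistributedSparse {p : ℕ} (d : ℕ) (X : Matrix (Fin p) (Fin p) ℝ) : Prop :=
  ∃ Ω : Finset (Fin p × Fin p), IsDistributed d Ω ∧ ∀ i j, X i j ≠ 0 → (i, j) ∈ Ω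

/-- The outcome of the random choices: `J i k` is the right endpoint in `[m]` of the `k`-th edge,
`k = 1, …, δ`, attached to the left vertex `i ∈ [p]`. -/
abbrev EdgeChoice (p m δ : ℕ) : Type := Fin p → Fin δ → Fin m

/-- The law of a uniformly random `δ`-left regular bipartite graph: all the endpoints `J i k` are
independent and uniformly distributed on `[m]` (sampling with replacement). -/
def graphLaw (p m δ : ℕ) : Measure (EdgeChoice p m δ) :=
  Measure.pi fun _ : Fin p => Measure.pi fun _ : Fin δ =>
    ProbabilityTheory.uniformOn (Set.univ : Set (Fin m))

/-- The `m × p` adjacency matrix with entries in `{0, 1}`: the `(j, i)` entry is `1` if and only if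
`{i, j}` is an edge. -/
def adjacency {p m δ : ℕ} (J : EdgeChoice p m δ) : Matrix (Fin m) (Fin p) ℝ :=
  Matrix.of fun j i => if ∃ k, J i k = j then 1 else 0

/-- The `m × p` adjacency matrix counting multiplicities: the `(j, i)` entry is the number of
parallel edges between `i` and `j`. -/
def multiAdjacency {p m δ : ℕ} (J : EdgeChoice p m δ) : Matrix (Fin m) (Fin p) ℝ :=
  Matrix.of fun j i => ((Finset.univ.filter fun k => J i k = j).card : ℝ)

/-- The entrywise `ℓ₁` norm of a matrix. -/
def l1Norm {p : ℕ} (X : Matrix (Fin p) (Fin p) ℝ) : ℝ := ∑ i, ∑ j, |X i j|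

/-- The feasible set of the program
(P₁): minimize `‖Z‖₁` subject to `A Z Bᵀ = Y`. -/
def feasibleSet {p m : ℕ} (A B : Matrix (Fin m) (Fin p) ℝ) (Y : Matrix (Fin m) (Fin m) ℝ) :
    Set (Matrix (Fin p) (Fin p) ℝ) :=
  {Z | A * Z * B.transpose = Y}

/-- `Z` is an optimal solution of (P₁). -/
def IsOptimal {p m : ℕ} (A B : Matrix (Fin m) (Fin p) ℝ) (Y : Matrix (Fin m) (Fin m) ℝ)
    (Z : Matrix (Fin p) (Fin p) ℝ) : Prop :=
  Z ∈ feasibleSet A B Y ∧ ∀ W ∈ feasibleSet A B Y, l1Norm Z ≤ l1Norm W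

/-- Exact recovery: `X` is an optimal solution of (P₁) with data `Y = A X Bᵀ`, and it is the only
one. -/
def Recovers {p m : ℕ} (A B : Matrix (Fin m) (Fin p) ℝ) (X : Matrix (Fin p) (Fin p) ℝ) : Prop :=
  ∀ Z, IsOptimal A B (A * X * B.transpose) Z ↔ Z = X

end Sketch

end

/-!
The argument has a deterministic and a probabilistic half.

Deterministic half. Let `Ω` be a distributed set containing the support of `X`. An entry `e = (i, i')`
of the unknown matrix contributes to the rows `(j, j')` of the sketch `A * Z * Bᵀ` with
`j` a neighbour of `i` and `j'` a neighbour of `i'`, hence with about `δ ^ 2` edge pairs. Suppose that,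
for every `e`, only a small fraction of this weight lies on rows also met by another entry
of `Ω`. Then for `Z` in the kernel of the sketching map, each `e ∈ Ω` is alone in `Ω` on most of its
rows, where it has to be cancelled by entries outside `Ω`, each of which puts little weight on rows
met by `Ω`. So the `ℓ₁` mass of a nonzero `Z` on `Ω` is smaller than that outside
(`sum_abs_lt_of_sketch_eq_zero`), and `X` is the unique minimizer (`recovers_of_overlap_le`). The
required property of the graphs is `IsSpread`; it covers both kinds of adjacency matrices at once.

Probabilistic half. The two cases are treated together: there is one random graph on a
vertex set `V` and two injections `α β : [p] → V`, which are the identity if `B = A` and have disjoint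
ranges if `A` and `B` are independent. The only probabilistic tool is an exponential moment bound
(`sum_prod_weight_le`): edges hit adaptively chosen targets of density `θ` at least `s` times with
probability at most `2 ^ δ * θ ^ s`. Fix `e`. The rows met by entries of `Ω` that avoid the
vertices `α i`, `β i'` have density at most `d * p * δ ^ 2 / m ^ 2 ≤ θ ^ 2`, and they are independent of
the edges at these two vertices. Exposing first the edges at `α i`, few of them end at a point whose
section has density more than `θ`; above the others, the edges at `β i'` rarely hit the section. If
`α i = β i'`, pairs formed by an edge with itself have to be discarded, at a cost of `δ`, which is
negligible for `δ ≥ 32`. The entries of `Ω` that involve `α i` or `β i'` are handled by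
`card_collidingPairs_le`: they force an edge to hit a set of density at most `θ`. With `s = δ / 32`
and `θ` a small constant, all these failure probabilities are smaller than any given power of `1 / p`,
because `δ ≥ a * log p`, and a union bound over `e` applies (`ncard_not_isSpread_le`). If `δ < 32`, then
`p` is bounded in terms of `a`, and for large `C` all edges have distinct endpoints with high
probability. Thus `c = 1` works.
-/

noncomputable section

namespace Sketch

/-! ### Tail bounds for uniformly random functions -/

section Tail

variable {I M : Type*} [Fintype I] [DecidableEq I] [Fintype M]

/-- Resampling one coordinate of a uniformly random function does not change its law. -/
theorem sum_sum_update (r : I) (F : (I → M) → ℝ) :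
    ∑ J : I → M, ∑ y, F (Function.update J r y) = Fintype.card M * ∑ J, F J := by
  have hinv : Function.Involutive
      (fun q : (I → M) × M => (Function.update q.1 r q.2, q.1 r)) := by
    rintro ⟨J, y⟩
    simp
  rw [← Fintype.sum_prod_type' (f := fun J y => F (Function.update J r y))]
  calc ∑ q : (I → M) × M, F (Function.update q.1 r q.2)
      = ∑ q : (I → M) × M, F q.1 :=
        Fintype.sum_equiv hinv.toPerm _ _ fun _ => rfl
    _ = _ := by
        rw [Fintype.sum_prod_type]
        simp [Finset.mul_sum]

variable [DecidableEq M]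

/-- Exponential moment of the number of hits `J r ∈ T r J`, `r ∈ R`, when the targets `T r J` have
density at most `θ` and may depend on `J` adaptively: exposing the coordinates of `R` by increasing
rank `ρ`, each target is determined before its coordinate is drawn. -/
theorem sum_prod_weight_le [Nonempty M] (R : Finset I) (ρ : I → ℕ)
    (T : I → (I → M) → Finset M) {θ : ℝ} (hθ : 0 < θ)
    (hcard : ∀ r ∈ R, ∀ J, ((T r J).card : ℝ) ≤ θ * Fintype.card M)
    (hT : ∀ r ∈ R, ∀ r' ∈ R, ρ r ≤ ρ r' → ∀ J y, T r (Function.update J r' y) = T r J) :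
    ∑ J : I → M, ∏ r ∈ R, (if J r ∈ T r J then θ⁻¹ else 1) ≤
      2 ^ R.card * (Fintype.card M : ℝ) ^ Fintype.card I := by
  induction R using Finset.induction_on_max_value ρ with
  | empty => simp
  | insert a s ha hmax ih =>
    specialize ih (fun r hr => hcard r (Finset.mem_insert_of_mem hr))
      (fun r hr r' hr' => hT r (Finset.mem_insert_of_mem hr) r' (Finset.mem_insert_of_mem hr'))
    have hM : (0 : ℝ) < Fintype.card M := by exact_mod_cast Fintype.card_pos
    set P : (I → M) → ℝ := fun J => ∏ r ∈ s, (if J r ∈ T r J then θ⁻¹ else 1) with hP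
    have hP0 : ∀ J, 0 ≤ P J := fun J => Finset.prod_nonneg fun r _ => by
      split_ifs <;> positivity
    have hPu : ∀ J y, P (Function.update J a y) = P J := by
      intro J y
      refine Finset.prod_congr rfl fun r hr => ?_
      have hra : r ≠ a := fun h => ha (h ▸ hr)
      rw [Function.update_of_ne hra,
        hT r (Finset.mem_insert_of_mem hr) a (Finset.mem_insert_self _ _) (hmax r hr)]
    have hTa : ∀ J y, T a (Function.update J a y) = T a J :=
      hT a (Finset.mem_insert_self _ _) a (Finset.mem_insert_self _ _) le_rfl
    have hsum : ∀ J, ∑ y, (if y ∈ T a J then θ⁻¹ else (1 : ℝ)) ≤ 2 * Fintype.card M := by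
      intro J
      have h1 : ∀ y, (if y ∈ T a J then θ⁻¹ else (1 : ℝ)) ≤
          (if y ∈ T a J then θ⁻¹ else 0) + 1 := by
        intro y; split_ifs <;> simp
      refine (Finset.sum_le_sum fun y _ => h1 y).trans ?_
      rw [Finset.sum_add_distrib, ← Finset.sum_filter]
      have h2 : ((T a J).card : ℝ) * θ⁻¹ ≤ Fintype.card M := by
        rw [← div_eq_mul_inv, div_le_iff₀ hθ, mul_comm]
        exact hcard a (Finset.mem_insert_self _ _) J
      simp only [Finset.filter_univ_mem, Finset.sum_const, nsmul_eq_mul, Finset.card_univ, mul_one]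
      linarith
    simp only [Finset.prod_insert ha]
    have key := sum_sum_update a fun J => (if J a ∈ T a J then θ⁻¹ else (1 : ℝ)) * P J
    simp only [Function.update_self, hTa, hPu, ← Finset.sum_mul] at key
    have hle : ∑ J, (∑ y, (if y ∈ T a J then θ⁻¹ else (1 : ℝ))) * P J ≤
        2 * Fintype.card M * ∑ J, P J := by
      rw [Finset.mul_sum]
      exact Finset.sum_le_sum fun J _ => mul_le_mul_of_nonneg_right (hsum J) (hP0 J)
    rw [key] at hle
    have h3 : ∑ J, (if J a ∈ T a J then θ⁻¹ else (1 : ℝ)) * P J ≤ 2 * ∑ J, P J := by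
      refine le_of_mul_le_mul_left ?_ hM
      linarith
    rw [Finset.card_insert_of_notMem ha, pow_succ]
    linarith

/-- Markov's inequality applied to `sum_prod_weight_le`. -/
theorem ncard_hits_le [Nonempty M] (R : Finset I) (ρ : I → ℕ)
    (T : I → (I → M) → Finset M) {θ s : ℝ} (hθ : 0 < θ) (hθ1 : θ ≤ 1)
    (hcard : ∀ r ∈ R, ∀ J, ((T r J).card : ℝ) ≤ θ * Fintype.card M)
    (hT : ∀ r ∈ R, ∀ r' ∈ R, ρ r ≤ ρ r' → ∀ J y, T r (Function.update J r' y) = T r J) :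
    (({J : I → M | s ≤ ((R.filter fun r => J r ∈ T r J).card : ℝ)}.ncard : ℕ) : ℝ) ≤
      2 ^ R.card * θ ^ s * (Fintype.card M : ℝ) ^ Fintype.card I := by
  classical
  have h := sum_prod_weight_le R ρ T hθ hcard hT
  set E : Finset (I → M) :=
    Finset.univ.filter fun J => s ≤ ((R.filter fun r => J r ∈ T r J).card : ℝ) with hE
  have hEc : {J : I → M | s ≤ ((R.filter fun r => J r ∈ T r J).card : ℝ)}.ncard = E.card := by
    rw [← Set.ncard_coe_finset]
    congr 1
    ext J
    simp [hE]
  have hθs : 0 < θ ^ s := Real.rpow_pos_of_pos hθ s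
  have h1 : (E.card : ℝ) * (θ ^ s)⁻¹ ≤
      ∑ J : I → M, ∏ r ∈ R, (if J r ∈ T r J then θ⁻¹ else 1) := by
    rw [← nsmul_eq_mul, ← Finset.sum_const]
    refine (Finset.sum_le_sum fun J hJ => ?_).trans
      (Finset.sum_le_univ_sum_of_nonneg fun J => Finset.prod_nonneg fun r _ => ?_)
    · have hJ' : s ≤ ((R.filter fun r => J r ∈ T r J).card : ℝ) := by simpa [hE] using hJ
      rw [← Finset.prod_filter, Finset.prod_const, inv_pow]
      gcongr
      rw [← Real.rpow_natCast]
      exact Real.rpow_le_rpow_of_exponent_ge hθ hθ1 hJ'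
    · split_ifs <;> positivity
  rw [hEc]
  have h2 := h1.trans h
  rw [← div_eq_mul_inv, div_le_iff₀ hθs] at h2
  linarith

end Tail

section Star

variable {V : Type*} [Fintype V] [DecidableEq V] {m δ : ℕ}

/-- `ncard_hits_le` for the edges of a single left vertex `v`. -/
theorem ncard_star_hits_le [NeZero m] (v : V) (K : Finset (Fin δ))
    (T : Fin δ → (V × Fin δ → Fin m) → Finset (Fin m)) {θ s : ℝ} (hθ : 0 < θ) (hθ1 : θ ≤ 1)
    (hcard : ∀ k ∈ K, ∀ J, ((T k J).card : ℝ) ≤ θ * m)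
    (hT : ∀ k ∈ K, ∀ k' ∈ K, k ≤ k' → ∀ J y, T k (Function.update J (v, k') y) = T k J) :
    (({J : V × Fin δ → Fin m | s ≤ ((K.filter fun k => J (v, k) ∈ T k J).card : ℝ)}.ncard : ℕ) : ℝ)
      ≤ 2 ^ δ * θ ^ s * (m : ℝ) ^ Fintype.card (V × Fin δ) := by
  have h := ncard_hits_le (s := s) (K.map ⟨fun k => (v, k), Prod.mk_right_injective v⟩)
    (fun r => (r.2 : ℕ)) (fun r => T r.2) hθ hθ1 (by simpa using hcard) (by
      simp only [Finset.mem_map, Function.Embedding.coeFn_mk]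
      rintro r ⟨k, hk, rfl⟩ r' ⟨k', hk', rfl⟩ hkk'
      exact hT k hk k' hk' hkk')
  simp only [Finset.filter_map, Finset.card_map, Fintype.card_fin] at h
  refine h.trans ?_
  have hK : K.card ≤ δ := by simpa using Finset.card_le_univ K
  gcongr
  exact one_le_two

end Star

/-! ### Recovery from small overlaps -/

section Recovery

variable {p m : ℕ}

/-- The rows `(j, j')` of the sketch that receive a contribution from an entry of `Ω` other
than `e`. -/
def overlap (A B : Matrix (Fin m) (Fin p) ℝ) (Ω : Finset (Fin p × Fin p)) (e : Fin p × Fin p) :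
    Finset (Fin m × Fin m) :=
  Finset.univ.filter fun r => ∃ x ∈ Ω, x ≠ e ∧ A r.1 x.1 * B r.2 x.2 ≠ 0

theorem sketch_apply (A B : Matrix (Fin m) (Fin p) ℝ) (Z : Matrix (Fin p) (Fin p) ℝ)
    (r : Fin m × Fin m) :
    (A * Z * B.transpose) r.1 r.2 = ∑ x : Fin p × Fin p, Z x.1 x.2 * (A r.1 x.1 * B r.2 x.2) := by
  simp only [Matrix.mul_apply, Matrix.transpose_apply, Finset.sum_mul]
  rw [Finset.sum_comm, ← Fintype.sum_prod_type']
  exact Finset.sum_congr rfl fun x _ => by ring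

/-- A null space property: if every column of the sketching operator has weight more than `2 * O`,
of which at most `O` lies on rows met by other entries of `Ω`, then a nonzero matrix in its kernel has
more than half of its `ℓ₁` mass outside `Ω`. -/
theorem sum_abs_lt_of_sketch_eq_zero {A B : Matrix (Fin m) (Fin p) ℝ}
    (hA : ∀ j i, 0 ≤ A j i) (hB : ∀ j i, 0 ≤ B j i) (Ω : Finset (Fin p × Fin p)) {O W : ℝ}
    (hO : ∀ e, ∑ r ∈ overlap A B Ω e, A r.1 e.1 * B r.2 e.2 ≤ O)
    (hW : ∀ e : Fin p × Fin p, W ≤ ∑ r : Fin m × Fin m, A r.1 e.1 * B r.2 e.2)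
    (hOW : 2 * O < W) {Z : Matrix (Fin p) (Fin p) ℝ} (hZ : A * Z * B.transpose = 0) (hZ0 : Z ≠ 0) :
    ∑ x ∈ Ω, |Z x.1 x.2| < ∑ x ∈ Ωᶜ, |Z x.1 x.2| := by
  set w : Fin p × Fin p → Fin m × Fin m → ℝ := fun x r => A r.1 x.1 * B r.2 x.2 with hw
  have hw0 : ∀ x r, 0 ≤ w x r := fun x r => mul_nonneg (hA _ _) (hB _ _)
  -- On each row, the entry of `Ω` that is alone there (if any) is balanced by `Ωᶜ`.
  have hrow : ∀ r, ∑ x ∈ Ω, (if r ∈ overlap A B Ω x then 0 else |Z x.1 x.2| * w x r) ≤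
      ∑ x ∈ Ωᶜ, (if r ∈ overlap A B Ω x then |Z x.1 x.2| * w x r else 0) := by
    intro r
    have hz : ∑ x, Z x.1 x.2 * w x r = 0 := by
      rw [← sketch_apply, hZ]; rfl
    by_cases hall : ∀ x ∈ Ω, r ∈ overlap A B Ω x ∨ w x r = 0
    · rw [Finset.sum_eq_zero]
      · exact Finset.sum_nonneg fun x _ => by
          split_ifs
          · exact mul_nonneg (abs_nonneg _) (hw0 _ _)
          · exact le_rfl
      · intro x hx
        rcases hall x hx with h | h
        · simp [h]
        · simp [h]
    push Not at hall
    obtain ⟨x, hx, hxr, hxw⟩ := hall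
    have hother : ∀ y ∈ Ω, y ≠ x → w y r = 0 := by
      intro y hy hyx
      by_contra hne
      exact hxr (by simpa [overlap] using ⟨y.1, y.2, hy, hyx, by simpa [hw] using hne⟩)
    have hLHS : ∑ y ∈ Ω, (if r ∈ overlap A B Ω y then 0 else |Z y.1 y.2| * w y r) =
        |Z x.1 x.2| * w x r := by
      rw [Finset.sum_eq_single_of_mem x hx]
      · simp [hxr]
      · intro y hy hyx
        simp [hother y hy hyx]
    have hRHS : ∑ y ∈ Ωᶜ, (if r ∈ overlap A B Ω y then |Z y.1 y.2| * w y r else 0) =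
        ∑ y ∈ Ωᶜ, |Z y.1 y.2| * w y r := by
      refine Finset.sum_congr rfl fun y hy => if_pos ?_
      have hyx : x ≠ y := fun h => (Finset.mem_compl.1 hy) (h ▸ hx)
      simpa [overlap] using ⟨x.1, x.2, hx, hyx, by simpa [hw] using hxw⟩
    rw [← Finset.sum_add_sum_compl Ω, Finset.sum_eq_single_of_mem x hx
      (fun y hy hyx => by rw [hother y hy hyx, mul_zero])] at hz
    rw [hLHS, hRHS]
    calc |Z x.1 x.2| * w x r = |Z x.1 x.2 * w x r| := by rw [abs_mul, abs_of_nonneg (hw0 x r)]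
      _ = |∑ y ∈ Ωᶜ, Z y.1 y.2 * w y r| := by rw [eq_neg_of_add_eq_zero_left hz, abs_neg]
      _ ≤ ∑ y ∈ Ωᶜ, |Z y.1 y.2 * w y r| := Finset.abs_sum_le_sum_abs _ _
      _ = _ := Finset.sum_congr rfl fun y _ => by rw [abs_mul, abs_of_nonneg (hw0 y r)]
  have htot := Finset.sum_le_sum fun r (_ : r ∈ (Finset.univ : Finset (Fin m × Fin m))) => hrow r
  rw [Finset.sum_comm, Finset.sum_comm (s := Finset.univ) (t := Ωᶜ)] at htot
  have hleft : ∀ x ∈ Ω, |Z x.1 x.2| * (W - O) ≤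
      ∑ r, (if r ∈ overlap A B Ω x then 0 else |Z x.1 x.2| * w x r) := by
    intro x _
    have h1 := Finset.sum_add_sum_compl (overlap A B Ω x) (w x)
    have h2 : ∑ r, (if r ∈ overlap A B Ω x then 0 else |Z x.1 x.2| * w x r) =
        |Z x.1 x.2| * ∑ r ∈ (overlap A B Ω x)ᶜ, w x r := by
      rw [Finset.mul_sum, ← Finset.sum_subset (Finset.subset_univ (overlap A B Ω x)ᶜ)]
      · exact Finset.sum_congr rfl fun r hr => if_neg (Finset.mem_compl.1 hr)
      · intro r _ hr
        exact if_pos (by simpa using hr)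
    rw [h2]
    have h3 := hO x
    have h4 := hW x
    exact mul_le_mul_of_nonneg_left (by simp only [hw] at h1 ⊢; linarith) (abs_nonneg _)
  have hright : ∀ x ∈ Ωᶜ, ∑ r, (if r ∈ overlap A B Ω x then |Z x.1 x.2| * w x r else 0) ≤
      |Z x.1 x.2| * O := by
    intro x _
    rw [← Finset.sum_filter, Finset.filter_univ_mem, ← Finset.mul_sum]
    exact mul_le_mul_of_nonneg_left (hO x) (abs_nonneg _)
  have hmain : (∑ x ∈ Ω, |Z x.1 x.2|) * (W - O) ≤ (∑ x ∈ Ωᶜ, |Z x.1 x.2|) * O := by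
    rw [Finset.sum_mul, Finset.sum_mul]
    exact (Finset.sum_le_sum hleft).trans (htot.trans (Finset.sum_le_sum hright))
  have hin : 0 ≤ ∑ x ∈ Ω, |Z x.1 x.2| := Finset.sum_nonneg fun _ _ => abs_nonneg _
  have hout : 0 ≤ ∑ x ∈ Ωᶜ, |Z x.1 x.2| := Finset.sum_nonneg fun _ _ => abs_nonneg _
  have hpos : 0 < ∑ x ∈ Ω, |Z x.1 x.2| + ∑ x ∈ Ωᶜ, |Z x.1 x.2| := by
    rw [Finset.sum_add_sum_compl]
    refine lt_of_le_of_ne (Finset.sum_nonneg fun _ _ => abs_nonneg _) fun h => hZ0 ?_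
    ext i j
    have := (Finset.sum_eq_zero_iff_of_nonneg fun _ _ => abs_nonneg _).1 h.symm (i, j)
      (Finset.mem_univ _)
    simpa using this
  obtain ⟨x₀⟩ : Nonempty (Fin p × Fin p) := by
    by_contra hne
    rw [not_nonempty_iff] at hne
    simp [Finset.eq_empty_of_isEmpty] at hpos
  have hO0 : 0 ≤ O := (Finset.sum_nonneg fun r _ => hw0 x₀ r).trans (hO x₀)
  by_contra! hcon
  rcases hin.eq_or_lt with h0 | h0
  · linarith
  · have : (∑ x ∈ Ωᶜ, |Z x.1 x.2|) * O ≤ (∑ x ∈ Ω, |Z x.1 x.2|) * O :=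
      mul_le_mul_of_nonneg_right hcon hO0
    have : (∑ x ∈ Ω, |Z x.1 x.2|) * O < (∑ x ∈ Ω, |Z x.1 x.2|) * (W - O) :=
      mul_lt_mul_of_pos_left (by linarith) h0
    linarith

theorem recovers_of_overlap_le {A B : Matrix (Fin m) (Fin p) ℝ}
    (hA : ∀ j i, 0 ≤ A j i) (hB : ∀ j i, 0 ≤ B j i) (Ω : Finset (Fin p × Fin p)) {O W : ℝ}
    (hO : ∀ e, ∑ r ∈ overlap A B Ω e, A r.1 e.1 * B r.2 e.2 ≤ O)
    (hW : ∀ e : Fin p × Fin p, W ≤ ∑ r : Fin m × Fin m, A r.1 e.1 * B r.2 e.2)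
    (hOW : 2 * O < W) {X : Matrix (Fin p) (Fin p) ℝ} (hX : ∀ i j, X i j ≠ 0 → (i, j) ∈ Ω) :
    Recovers A B X := by
  have hl1 : ∀ Z : Matrix (Fin p) (Fin p) ℝ,
      l1Norm Z = ∑ x ∈ Ω, |Z x.1 x.2| + ∑ x ∈ Ωᶜ, |Z x.1 x.2| := by
    intro Z
    rw [Finset.sum_add_sum_compl, Fintype.sum_prod_type]
    rfl
  have hlt : ∀ Z ∈ feasibleSet A B (A * X * B.transpose), Z ≠ X → l1Norm X < l1Norm Z := by
    intro Z hZ hne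
    have h := sum_abs_lt_of_sketch_eq_zero hA hB Ω hO hW hOW (Z := Z - X) (by
      have hZ' : A * Z * B.transpose = A * X * B.transpose := hZ
      rw [Matrix.mul_sub, Matrix.sub_mul, hZ', sub_self]) (sub_ne_zero.2 hne)
    have hX0 : ∀ x ∈ Ωᶜ, X x.1 x.2 = 0 := by
      intro x hx
      by_contra hx0
      exact Finset.mem_compl.1 hx (hX _ _ hx0)
    have h1 : ∑ x ∈ Ωᶜ, |(Z - X) x.1 x.2| = ∑ x ∈ Ωᶜ, |Z x.1 x.2| :=
      Finset.sum_congr rfl fun x hx => by rw [Matrix.sub_apply, hX0 x hx, sub_zero]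
    have h2 : ∑ x ∈ Ωᶜ, |X x.1 x.2| = 0 :=
      Finset.sum_eq_zero fun x hx => by rw [hX0 x hx, abs_zero]
    have h3 : ∑ x ∈ Ω, |X x.1 x.2| ≤ ∑ x ∈ Ω, |Z x.1 x.2| + ∑ x ∈ Ω, |(Z - X) x.1 x.2| := by
      rw [← Finset.sum_add_distrib]
      refine Finset.sum_le_sum fun x _ => ?_
      rw [Matrix.sub_apply]
      have := abs_sub_abs_le_abs_sub (X x.1 x.2) (Z x.1 x.2)
      rw [abs_sub_comm] at this
      linarith
    rw [hl1 X, hl1 Z]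
    linarith
  intro Z
  constructor
  · rintro ⟨hZ, hopt⟩
    by_contra hne
    exact absurd (hopt X rfl) (not_le.2 (hlt Z hZ hne))
  · rintro rfl
    refine ⟨rfl, fun W' hW' => ?_⟩
    by_cases h : W' = Z
    · rw [h]
    · exact (hlt W' hW' h).le

end Recovery

/-! ### Spread graphs -/

section Spread

variable {V : Type*} {p m δ : ℕ}

/-- The set of right endpoints of the edges at the left vertex `v`. -/
def nbhd (J : V × Fin δ → Fin m) (v : V) : Finset (Fin m) :=
  Finset.univ.image fun k => J (v, k)

theorem mem_nbhd {J : V × Fin δ → Fin m} {v : V} {j : Fin m} :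
    j ∈ nbhd J v ↔ ∃ k, J (v, k) = j := by
  simp [nbhd]

/-- The graph on `[p]` obtained by giving `i` the edges of the vertex `α i`. -/
def pullEdges (α : Fin p → V) (J : V × Fin δ → Fin m) : EdgeChoice p m δ := fun i k => J (α i, k)

theorem multiAdjacency_pullEdges (α : Fin p → V) (J : V × Fin δ → Fin m) (j : Fin m) (i : Fin p) :
    multiAdjacency (pullEdges α J) j i = ((Finset.univ.filter fun k => J (α i, k) = j).card : ℝ) :=
  rfl

/-- The pairs of edges at `α e.1` and `β e.2` that lead to a row of the sketch met by an entry
of `Ω` other than `e`. -/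
def collidingPairs (α β : Fin p → V) (Ω : Finset (Fin p × Fin p)) (J : V × Fin δ → Fin m)
    (e : Fin p × Fin p) : Finset (Fin δ × Fin δ) :=
  Finset.univ.filter fun q =>
    ∃ x ∈ Ω, x ≠ e ∧ J (α e.1, q.1) ∈ nbhd J (α x.1) ∧ J (β e.2, q.2) ∈ nbhd J (β x.2)

/-- Every entry of the unknown matrix has few colliding pairs of edges with `Ω`, and every left
vertex has few parallel edges. The constants only have to satisfy
`2 * (7 / 32) < (31 / 32) ^ 2`. -/
def IsSpread (α β : Fin p → V) (Ω : Finset (Fin p × Fin p)) (J : V × Fin δ → Fin m) : Prop :=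
  ∀ e, ((collidingPairs α β Ω J e).card : ℝ) ≤ 7 / 32 * (δ : ℝ) ^ 2 ∧
    31 / 32 * (δ : ℝ) ≤ (nbhd J (α e.1)).card ∧ 31 / 32 * (δ : ℝ) ≤ (nbhd J (β e.2)).card

theorem IsSpread.recovers {α β : Fin p → V} {Ω : Finset (Fin p × Fin p)} {J : V × Fin δ → Fin m}
    (h : IsSpread α β Ω J) (hδ : 0 < δ) {A B : Matrix (Fin m) (Fin p) ℝ}
    (hA0 : ∀ j i, 0 ≤ A j i) (hB0 : ∀ j i, 0 ≤ B j i)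
    (hA : ∀ j i, A j i ≤ multiAdjacency (pullEdges α J) j i)
    (hB : ∀ j i, B j i ≤ multiAdjacency (pullEdges β J) j i)
    (hAs : ∀ i, ((nbhd J (α i)).card : ℝ) ≤ ∑ j, A j i)
    (hBs : ∀ i, ((nbhd J (β i)).card : ℝ) ≤ ∑ j, B j i)
    {X : Matrix (Fin p) (Fin p) ℝ} (hX : ∀ i j, X i j ≠ 0 → (i, j) ∈ Ω) : Recovers A B X := by
  have hmem : ∀ (γ : Fin p → V) j i, multiAdjacency (pullEdges γ J) j i ≠ 0 →
      j ∈ nbhd J (γ i) := by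
    intro γ j i hne
    simp only [multiAdjacency, Matrix.of_apply, ne_eq, Nat.cast_eq_zero, Finset.card_eq_zero,
      Finset.filter_eq_empty_iff, Finset.mem_univ, true_implies, not_forall, not_not] at hne
    obtain ⟨k, hk⟩ := hne
    exact mem_nbhd.2 ⟨k, hk⟩
  have hδ' : (0 : ℝ) < δ := by exact_mod_cast hδ
  refine recovers_of_overlap_le (O := 7 / 32 * (δ : ℝ) ^ 2)
    (W := (31 / 32 * (δ : ℝ)) * (31 / 32 * (δ : ℝ))) hA0 hB0 Ω (fun e => ?_) (fun e => ?_)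
    (by nlinarith [mul_pos hδ' hδ']) hX
  · refine le_trans ?_ (h e).1
    set f : Fin δ × Fin δ → Fin m × Fin m := fun q => (J (α e.1, q.1), J (β e.2, q.2)) with hf
    have h1 : ∀ r : Fin m × Fin m, A r.1 e.1 * B r.2 e.2 ≤
        ((Finset.univ.filter fun q => f q = r).card : ℝ) := by
      intro r
      refine (mul_le_mul (hA _ _) (hB _ _) (hB0 _ _) ((hA0 _ _).trans (hA _ _))).trans
        (le_of_eq ?_)
      rw [multiAdjacency_pullEdges, multiAdjacency_pullEdges, ← Nat.cast_mul, ← Finset.card_product]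
      congr 2
      ext q
      simp only [Finset.mem_filter, Finset.mem_univ, true_and, Finset.mem_product, hf,
        Prod.ext_iff]
    refine (Finset.sum_le_sum fun r _ => h1 r).trans ?_
    rw [← Nat.cast_sum, Nat.cast_le]
    have h2 := Finset.card_eq_sum_card_fiberwise (f := f)
      (s := Finset.univ.filter fun q => f q ∈ overlap A B Ω e) (t := overlap A B Ω e)
      (fun q hq => by simpa using hq)
    have h3 : ∑ r ∈ overlap A B Ω e, (Finset.univ.filter fun q => f q = r).card =
        (Finset.univ.filter fun q => f q ∈ overlap A B Ω e).card := by
      rw [h2]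
      refine Finset.sum_congr rfl fun r hr => ?_
      rw [Finset.filter_filter]
      congr 1
      ext q
      simp only [Finset.mem_filter, Finset.mem_univ, true_and]
      exact ⟨fun hq => ⟨hq ▸ hr, hq⟩, fun hq => hq.2⟩
    rw [h3]
    refine Finset.card_le_card fun q hq => ?_
    simp only [overlap, Finset.mem_filter, Finset.mem_univ, true_and] at hq
    obtain ⟨x, hx, hxe, hne⟩ := hq
    have hAx := (hA0 _ _).lt_of_ne' (left_ne_zero_of_mul hne)
    have hBx := (hB0 _ _).lt_of_ne' (right_ne_zero_of_mul hne)
    exact Finset.mem_filter.2 ⟨Finset.mem_univ _, x, hx, hxe,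
      hmem α _ _ (hAx.trans_le (hA _ _)).ne', hmem β _ _ (hBx.trans_le (hB _ _)).ne'⟩
  · rw [Fintype.sum_prod_type' (f := fun j j' => A j e.1 * B j' e.2), ← Finset.sum_mul_sum]
    exact mul_le_mul ((h e).2.1.trans (hAs _)) ((h e).2.2.trans (hBs _)) (by positivity)
      (Finset.sum_nonneg fun _ _ => hA0 _ _)

theorem adjacency_nonneg (G : EdgeChoice p m δ) (j : Fin m) (i : Fin p) :
    0 ≤ adjacency G j i := by
  simp only [adjacency, Matrix.of_apply]
  split_ifs <;> simp

theorem multiAdjacency_nonneg (G : EdgeChoice p m δ) (j : Fin m) (i : Fin p) :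
    0 ≤ multiAdjacency G j i := by
  simp [multiAdjacency]

theorem adjacency_le_multiAdjacency (G : EdgeChoice p m δ) (j : Fin m) (i : Fin p) :
    adjacency G j i ≤ multiAdjacency G j i := by
  simp only [adjacency, multiAdjacency, Matrix.of_apply]
  split_ifs with hk
  · obtain ⟨k, hk⟩ := hk
    rw [Nat.one_le_cast, Nat.one_le_iff_ne_zero, Finset.card_ne_zero]
    exact ⟨k, by simpa using hk⟩
  · positivity

theorem card_nbhd_le_sum_adjacency (α : Fin p → V) (J : V × Fin δ → Fin m) (i : Fin p) :
    ((nbhd J (α i)).card : ℝ) ≤ ∑ j, adjacency (pullEdges α J) j i := by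
  simp only [adjacency, Matrix.of_apply, Finset.sum_boole, Nat.cast_le]
  refine Finset.card_le_card fun j hj => ?_
  exact Finset.mem_filter.2 ⟨Finset.mem_univ _, mem_nbhd.1 hj⟩

/-- Both kinds of adjacency matrices of spread graphs allow recovery. -/
theorem IsSpread.recovers_adjacency {α β : Fin p → V} {Ω : Finset (Fin p × Fin p)}
    {J : V × Fin δ → Fin m} (h : IsSpread α β Ω J) (hδ : 0 < δ)
    {X : Matrix (Fin p) (Fin p) ℝ} (hX : ∀ i j, X i j ≠ 0 → (i, j) ∈ Ω) :
    Recovers (adjacency (pullEdges α J)) (adjacency (pullEdges β J)) X ∧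
      Recovers (multiAdjacency (pullEdges α J)) (multiAdjacency (pullEdges β J)) X := by
  refine ⟨h.recovers hδ (adjacency_nonneg _) (adjacency_nonneg _) (adjacency_le_multiAdjacency _)
      (adjacency_le_multiAdjacency _) (card_nbhd_le_sum_adjacency α J)
      (card_nbhd_le_sum_adjacency β J) hX,
    h.recovers hδ (multiAdjacency_nonneg _) (multiAdjacency_nonneg _) (fun _ _ => le_rfl)
      (fun _ _ => le_rfl) (fun i => ?_) (fun i => ?_) hX⟩
  · exact (card_nbhd_le_sum_adjacency α J i).trans
      (Finset.sum_le_sum fun j _ => adjacency_le_multiAdjacency _ j i)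
  · exact (card_nbhd_le_sum_adjacency β J i).trans
      (Finset.sum_le_sum fun j _ => adjacency_le_multiAdjacency _ j i)

theorem card_nbhd_le (J : V × Fin δ → Fin m) (v : V) : (nbhd J v).card ≤ δ :=
  Finset.card_image_le.trans (by simp)

/-- If the edges have distinct endpoints, then no pair of edges collides. -/
theorem isSpread_of_injective {α β : Fin p → V} (hα : Function.Injective α)
    (hβ : Function.Injective β) (Ω : Finset (Fin p × Fin p)) {J : V × Fin δ → Fin m}
    (hJ : Function.Injective J) : IsSpread α β Ω J := by
  have hcard : ∀ v, 31 / 32 * (δ : ℝ) ≤ (nbhd J v).card := by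
    intro v
    rw [nbhd, Finset.card_image_of_injective _ fun k k' hkk' => (Prod.ext_iff.1 (hJ hkk')).2]
    have : (0 : ℝ) ≤ δ := by positivity
    simp only [Finset.card_univ, Fintype.card_fin]
    linarith
  refine fun e => ⟨?_, hcard _, hcard _⟩
  have : collidingPairs α β Ω J e = ∅ := by
    refine Finset.filter_eq_empty_iff.2 ?_
    rintro q - ⟨x, -, hxe, h1, h2⟩
    simp only [nbhd, Finset.mem_image, Finset.mem_univ, true_and] at h1 h2
    obtain ⟨k, hk⟩ := h1
    obtain ⟨k', hk'⟩ := h2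
    exact hxe (Prod.ext (hα (Prod.ext_iff.1 (hJ hk)).1) (hβ (Prod.ext_iff.1 (hJ hk')).1))
  rw [this]
  simp only [Finset.card_empty, Nat.cast_zero]
  positivity

end Spread

/-! ### Sources of collisions -/

section Sources

variable {V : Type*} {p m δ : ℕ}

/-- The endpoints of the edges at `v` drawn before the `k`-th one. -/
def earlier (v : V) (k : Fin δ) (J : V × Fin δ → Fin m) : Finset (Fin m) :=
  (Finset.univ.filter (· < k)).image fun k' => J (v, k')

/-- The edges at `v` within `K` whose endpoint lies in its target. -/
def hits (v : V) (K : Finset (Fin δ)) (T : Fin δ → (V × Fin δ → Fin m) → Finset (Fin m))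
    (J : V × Fin δ → Fin m) : Finset (Fin δ) :=
  K.filter fun k => J (v, k) ∈ T k J

theorem mem_hits {v : V} {K : Finset (Fin δ)}
    {T : Fin δ → (V × Fin δ → Fin m) → Finset (Fin m)} {J : V × Fin δ → Fin m} {k : Fin δ} :
    k ∈ hits v K T J ↔ k ∈ K ∧ J (v, k) ∈ T k J :=
  Finset.mem_filter

/-- A vertex with few edges repeating an earlier endpoint has many neighbours. -/
theorem le_card_nbhd_add_hits_earlier (J : V × Fin δ → Fin m) (v : V) :
    δ ≤ (nbhd J v).card + (hits v Finset.univ (earlier v) J).card := by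
  have h1 := Finset.card_filter_add_card_filter_not (s := (Finset.univ : Finset (Fin δ)))
    (fun k => J (v, k) ∈ earlier v k J)
  have h2 : (Finset.univ.filter fun k => J (v, k) ∉ earlier v k J).card ≤ (nbhd J v).card := by
    refine Finset.card_le_card_of_injOn (fun k => J (v, k))
      (fun k _ => Finset.mem_coe.2 (Finset.mem_image_of_mem _ (Finset.mem_univ _))) ?_
    intro k hk k' hk' hkk'
    simp only [earlier, Finset.coe_filter, Finset.mem_image, Finset.mem_filter, Finset.mem_univ,
      true_and, not_exists, not_and, Set.mem_ofPred_eq] at hk hk'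
    rcases lt_trichotomy k k' with h | h | h
    · exact absurd hkk' (hk' k h)
    · exact h
    · exact absurd hkk'.symm (hk k' h)
  simp only [Finset.card_univ, Fintype.card_fin] at h1
  unfold hits
  omega

variable [DecidableEq V]

theorem nbhd_update (J : V × Fin δ → Fin m) {v w : V} (h : w ≠ v) (k : Fin δ) (y : Fin m) :
    nbhd (Function.update J (v, k) y) w = nbhd J w := by
  unfold nbhd
  congr 1
  funext k'
  rw [Function.update_of_ne]
  exact fun h' => h (Prod.ext_iff.1 h').1

/-- The rows of the sketch met by entries of `Ω` that involve neither of the left vertices `α e.1`,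
`β e.2`. -/
def farRows (α β : Fin p → V) (Ω : Finset (Fin p × Fin p)) (e : Fin p × Fin p)
    (J : V × Fin δ → Fin m) : Finset (Fin m × Fin m) :=
  (Ω.filter fun x => (α x.1 ≠ α e.1 ∧ α x.1 ≠ β e.2) ∧ β x.2 ≠ α e.1 ∧ β x.2 ≠ β e.2).biUnion
    fun x => nbhd J (α x.1) ×ˢ nbhd J (β x.2)

/-- The section of `farRows` above `j`. -/
def farSlice (α β : Fin p → V) (Ω : Finset (Fin p × Fin p)) (e : Fin p × Fin p)
    (J : V × Fin δ → Fin m) (j : Fin m) : Finset (Fin m) :=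
  Finset.univ.filter fun j' => (j, j') ∈ farRows α β Ω e J

/-- The points above which the section of `farRows` has density more than `θ`. -/
def heavy (α β : Fin p → V) (Ω : Finset (Fin p × Fin p)) (e : Fin p × Fin p) (θ : ℝ)
    (J : V × Fin δ → Fin m) : Finset (Fin m) :=
  Finset.univ.filter fun j => θ * m < (farSlice α β Ω e J j).card

/-- The neighbours of the other entries of `Ω` in the row of `e`. -/
def rowNbhd (β : Fin p → V) (Ω : Finset (Fin p × Fin p)) (e : Fin p × Fin p)
    (J : V × Fin δ → Fin m) : Finset (Fin m) :=
  (Ω.filter fun x => x.1 = e.1 ∧ x ≠ e).biUnion fun x => nbhd J (β x.2)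

/-- The neighbours of the other entries of `Ω` in the column of `e`. -/
def colNbhd (α : Fin p → V) (Ω : Finset (Fin p × Fin p)) (e : Fin p × Fin p)
    (J : V × Fin δ → Fin m) : Finset (Fin m) :=
  (Ω.filter fun x => x.2 = e.2 ∧ x ≠ e).biUnion fun x => nbhd J (α x.1)

/-- The neighbours of `w`, as a target for the edges at `v`; empty if `v = w`. -/
def crossNbhd (v w : V) (J : V × Fin δ → Fin m) : Finset (Fin m) :=
  if v = w then ∅ else nbhd J w

/-- The section of `farRows` above the endpoint of the `k`-th edge at `α e.1`, unless that
endpoint is heavy. -/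
def lightSlice (α β : Fin p → V) (Ω : Finset (Fin p × Fin p)) (e : Fin p × Fin p) (θ : ℝ)
    (k : Fin δ) (J : V × Fin δ → Fin m) : Finset (Fin m) :=
  if J (α e.1, k) ∈ heavy α β Ω e θ J then ∅ else farSlice α β Ω e J (J (α e.1, k))

/-- Every colliding pair of edges has one of seven sources: a heavy endpoint, a light section of the
far rows, two edges with the same label, another entry of `Ω` in the row or in the column of `e`,
or an entry of `Ω` sharing a left vertex with `e` across the two factors (possible only if the two
factors share vertices). -/
theorem card_collidingPairs_le {α β : Fin p → V} (hα : Function.Injective α)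
    (hβ : Function.Injective β) (Ω : Finset (Fin p × Fin p)) (e : Fin p × Fin p) (θ : ℝ)
    (J : V × Fin δ → Fin m) {s : ℝ} (hs : 1 ≤ s)
    (h1 : ((hits (α e.1) Finset.univ (fun _ => heavy α β Ω e θ) J).card : ℝ) ≤ s)
    (h2 : ∀ k, ((hits (β e.2) (Finset.univ.erase k)
      (fun _ => lightSlice α β Ω e θ k) J).card : ℝ) ≤ s)
    (h3 : ((hits (β e.2) Finset.univ (fun _ => rowNbhd β Ω e) J).card : ℝ) ≤ s)
    (h4 : ((hits (α e.1) Finset.univ (fun _ => colNbhd α Ω e) J).card : ℝ) ≤ s)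
    (h5 : ((hits (α e.1) Finset.univ (fun _ => crossNbhd (α e.1) (β e.2)) J).card : ℝ) ≤ s)
    (h6 : ((hits (β e.2) Finset.univ (fun _ => crossNbhd (β e.2) (α e.1)) J).card : ℝ) ≤ s) :
    ((collidingPairs α β Ω J e).card : ℝ) ≤ 7 * s * δ := by
  set H1 := hits (α e.1) Finset.univ (fun _ => heavy α β Ω e θ) J with hH1
  set H2 := fun k => hits (β e.2) (Finset.univ.erase k) (fun _ => lightSlice α β Ω e θ k) J
    with hH2
  set H3 := hits (β e.2) Finset.univ (fun _ => rowNbhd β Ω e) J with hH3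
  set H4 := hits (α e.1) Finset.univ (fun _ => colNbhd α Ω e) J with hH4
  set H5 := hits (α e.1) Finset.univ (fun _ => crossNbhd (α e.1) (β e.2)) J with hH5
  set H6 := hits (β e.2) Finset.univ (fun _ => crossNbhd (β e.2) (α e.1)) J with hH6
  have hsub : collidingPairs α β Ω J e ⊆
      H1 ×ˢ Finset.univ ∪ (Finset.univ.biUnion fun k => (H2 k).image (Prod.mk k)) ∪
        Finset.univ.image (fun k => (k, k)) ∪ Finset.univ ×ˢ H3 ∪ H4 ×ˢ Finset.univ ∪
        H5 ×ˢ Finset.univ ∪ Finset.univ ×ˢ H6 := by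
    rintro ⟨k, k'⟩ hq
    simp only [collidingPairs, Finset.mem_filter, Finset.mem_univ, true_and] at hq
    obtain ⟨x, hx, hxe, hJ1, hJ2⟩ := hq
    simp only [Finset.mem_union, Finset.mem_product, Finset.mem_biUnion, Finset.mem_image,
      Prod.mk.injEq, Finset.mem_univ, true_and, and_true, exists_eq_left, exists_eq_right_right]
    by_cases hx1 : x.1 = e.1
    · have : k' ∈ H3 := mem_hits.2 ⟨Finset.mem_univ _, Finset.mem_biUnion.2
        ⟨x, Finset.mem_filter.2 ⟨hx, hx1, hxe⟩, hJ2⟩⟩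
      tauto
    by_cases hx2 : x.2 = e.2
    · have : k ∈ H4 := mem_hits.2 ⟨Finset.mem_univ _, Finset.mem_biUnion.2
        ⟨x, Finset.mem_filter.2 ⟨hx, hx2, hxe⟩, hJ1⟩⟩
      tauto
    have ha : α x.1 ≠ α e.1 := fun h => hx1 (hα h)
    have hb : β x.2 ≠ β e.2 := fun h => hx2 (hβ h)
    by_cases hx3 : α x.1 = β e.2
    · have : k ∈ H5 := by
        refine mem_hits.2 ⟨Finset.mem_univ _, ?_⟩
        rw [crossNbhd, if_neg (fun h => ha (hx3.trans h.symm)), ← hx3]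
        exact hJ1
      tauto
    by_cases hx4 : β x.2 = α e.1
    · have : k' ∈ H6 := by
        refine mem_hits.2 ⟨Finset.mem_univ _, ?_⟩
        rw [crossNbhd, if_neg (fun h => hb (hx4.trans h.symm)), ← hx4]
        exact hJ2
      tauto
    have hfar : (J (α e.1, k), J (β e.2, k')) ∈ farRows α β Ω e J := by
      simp only [farRows, Finset.mem_biUnion, Finset.mem_filter, Finset.mem_product]
      exact ⟨x, ⟨hx, ⟨ha, hx3⟩, hx4, hb⟩, hJ1, hJ2⟩
    by_cases hkk : k' = k
    · simp [hkk]
    by_cases hk : J (α e.1, k) ∈ heavy α β Ω e θ J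
    · have : k ∈ H1 := mem_hits.2 ⟨Finset.mem_univ _, hk⟩
      tauto
    · have : k' ∈ H2 k := by
        refine mem_hits.2 ⟨Finset.mem_erase.2 ⟨hkk, Finset.mem_univ _⟩, ?_⟩
        rw [lightSlice, if_neg hk]
        exact Finset.mem_filter.2 ⟨Finset.mem_univ _, hfar⟩
      simp [this]
  have hc : (collidingPairs α β Ω J e).card ≤ H1.card * δ + ∑ k, (H2 k).card + δ + δ * H3.card +
      H4.card * δ + H5.card * δ + δ * H6.card := by
    have hUc : (Finset.univ : Finset (Fin δ)).card = δ := by simp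
    refine (Finset.card_le_card hsub).trans ?_
    refine (Finset.card_union_le _ _).trans (add_le_add ?_ (by simp [hUc]))
    refine (Finset.card_union_le _ _).trans (add_le_add ?_ (by simp [hUc]))
    refine (Finset.card_union_le _ _).trans (add_le_add ?_ (by simp [hUc]))
    refine (Finset.card_union_le _ _).trans (add_le_add ?_ (by simp [hUc]))
    refine (Finset.card_union_le _ _).trans (add_le_add ?_ (Finset.card_image_le.trans hUc.le))
    refine (Finset.card_union_le _ _).trans (add_le_add (by simp [hUc]) ?_)
    exact Finset.card_biUnion_le.trans (Finset.sum_le_sum fun k _ => Finset.card_image_le)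
  have hδ : (0 : ℝ) ≤ δ := by positivity
  have hsum : ∑ k, ((H2 k).card : ℝ) ≤ δ * s := by
    refine (Finset.sum_le_sum fun k _ => h2 k).trans ?_
    simp
  have hc' : ((collidingPairs α β Ω J e).card : ℝ) ≤ H1.card * δ + ∑ k, ((H2 k).card : ℝ) + δ +
      δ * H3.card + H4.card * δ + H5.card * δ + δ * H6.card := by exact_mod_cast hc
  nlinarith [mul_le_mul_of_nonneg_right h1 hδ, mul_le_mul_of_nonneg_right h3 hδ,
    mul_le_mul_of_nonneg_right h4 hδ, mul_le_mul_of_nonneg_right h5 hδ,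
    mul_le_mul_of_nonneg_right h6 hδ, mul_le_mul_of_nonneg_right hs hδ]

end Sources

/-! ### Random graphs are spread -/

section Probability

variable {V : Type*} {p m δ d : ℕ} {Ω : Finset (Fin p × Fin p)}

theorem card_earlier_le (v : V) (k : Fin δ) (J : V × Fin δ → Fin m) : (earlier v k J).card ≤ δ :=
  Finset.card_image_le.trans ((Finset.card_filter_le _ _).trans (by simp))

theorem card_filter_fst_le (k : Fin p) : (Ω.filter fun x => x.1 = k).card ≤ p := by
  have : (Ω.filter fun x => x.1 = k).card ≤ (Finset.univ : Finset (Fin p)).card :=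
    Finset.card_le_card_of_injOn Prod.snd (fun _ _ => Finset.mem_univ _) fun x hx y hy h =>
      Prod.ext ((Finset.mem_filter.1 hx).2.trans (Finset.mem_filter.1 hy).2.symm) h
  simpa using this

theorem card_filter_snd_le (k : Fin p) : (Ω.filter fun x => x.2 = k).card ≤ p := by
  have : (Ω.filter fun x => x.2 = k).card ≤ (Finset.univ : Finset (Fin p)).card :=
    Finset.card_le_card_of_injOn Prod.fst (fun _ _ => Finset.mem_univ _) fun x hx y hy h =>
      Prod.ext h ((Finset.mem_filter.1 hx).2.trans (Finset.mem_filter.1 hy).2.symm)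
  simpa using this

theorem card_rowNbhd_le (hΩ : IsDistributed d Ω) (β : Fin p → V) (e : Fin p × Fin p)
    (J : V × Fin δ → Fin m) : (rowNbhd β Ω e J).card ≤ min d p * δ := by
  refine (Finset.card_biUnion_le_card_mul _ _ δ fun x _ => card_nbhd_le _ _).trans
    (Nat.mul_le_mul_right _ ?_)
  rw [← Finset.filter_filter]
  exact (Finset.card_filter_le _ _).trans (le_min (hΩ.2 _).1 (card_filter_fst_le _))

theorem card_colNbhd_le (hΩ : IsDistributed d Ω) (α : Fin p → V) (e : Fin p × Fin p)
    (J : V × Fin δ → Fin m) : (colNbhd α Ω e J).card ≤ min d p * δ := by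
  refine (Finset.card_biUnion_le_card_mul _ _ δ fun x _ => card_nbhd_le _ _).trans
    (Nat.mul_le_mul_right _ ?_)
  rw [← Finset.filter_filter]
  exact (Finset.card_filter_le _ _).trans (le_min (hΩ.2 _).2 (card_filter_snd_le _))

variable [DecidableEq V]

theorem farRows_update (α β : Fin p → V) (Ω : Finset (Fin p × Fin p)) (e : Fin p × Fin p)
    (J : V × Fin δ → Fin m) {v : V} (hv : v = α e.1 ∨ v = β e.2) (k : Fin δ) (y : Fin m) :
    farRows α β Ω e (Function.update J (v, k) y) = farRows α β Ω e J := by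
  refine Finset.biUnion_congr rfl fun x hx => ?_
  obtain ⟨-, ⟨h1, h2⟩, h3, h4⟩ := Finset.mem_filter.1 hx
  rcases hv with rfl | rfl
  · rw [nbhd_update J h1, nbhd_update J h3]
  · rw [nbhd_update J h2, nbhd_update J h4]

theorem farSlice_update (α β : Fin p → V) (Ω : Finset (Fin p × Fin p)) (e : Fin p × Fin p)
    (J : V × Fin δ → Fin m) {v : V} (hv : v = α e.1 ∨ v = β e.2) (k : Fin δ) (y : Fin m) :
    farSlice α β Ω e (Function.update J (v, k) y) = farSlice α β Ω e J := by
  funext j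
  rw [farSlice, farRows_update α β Ω e J hv, farSlice]

theorem heavy_update (α β : Fin p → V) (Ω : Finset (Fin p × Fin p)) (e : Fin p × Fin p) (θ : ℝ)
    (J : V × Fin δ → Fin m) {v : V} (hv : v = α e.1 ∨ v = β e.2) (k : Fin δ) (y : Fin m) :
    heavy α β Ω e θ (Function.update J (v, k) y) = heavy α β Ω e θ J := by
  rw [heavy, farSlice_update α β Ω e J hv, heavy]

theorem lightSlice_update (α β : Fin p → V) (Ω : Finset (Fin p × Fin p)) (e : Fin p × Fin p)
    (θ : ℝ) {k k' : Fin δ} (hk : k' ≠ k) (J : V × Fin δ → Fin m) (y : Fin m) :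
    lightSlice α β Ω e θ k (Function.update J (β e.2, k') y) = lightSlice α β Ω e θ k J := by
  have h : (α e.1, k) ≠ (β e.2, k') := fun h => hk (Prod.ext_iff.1 h).2.symm
  rw [lightSlice, heavy_update α β Ω e θ J (Or.inr rfl), farSlice_update α β Ω e J (Or.inr rfl),
    Function.update_of_ne h, lightSlice]

theorem rowNbhd_update {β : Fin p → V} (hβ : Function.Injective β) (Ω : Finset (Fin p × Fin p))
    (e : Fin p × Fin p) (J : V × Fin δ → Fin m) (k : Fin δ) (y : Fin m) :
    rowNbhd β Ω e (Function.update J (β e.2, k) y) = rowNbhd β Ω e J := by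
  refine Finset.biUnion_congr rfl fun x hx => ?_
  obtain ⟨-, h1, h2⟩ := Finset.mem_filter.1 hx
  exact nbhd_update J (fun h => h2 (Prod.ext h1 (hβ h))) k y

theorem colNbhd_update {α : Fin p → V} (hα : Function.Injective α) (Ω : Finset (Fin p × Fin p))
    (e : Fin p × Fin p) (J : V × Fin δ → Fin m) (k : Fin δ) (y : Fin m) :
    colNbhd α Ω e (Function.update J (α e.1, k) y) = colNbhd α Ω e J := by
  refine Finset.biUnion_congr rfl fun x hx => ?_
  obtain ⟨-, h1, h2⟩ := Finset.mem_filter.1 hx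
  exact nbhd_update J (fun h => h2 (Prod.ext (hα h) h1)) k y

theorem crossNbhd_update (v w : V) (J : V × Fin δ → Fin m) (k : Fin δ) (y : Fin m) :
    crossNbhd v w (Function.update J (v, k) y) = crossNbhd v w J := by
  unfold crossNbhd
  split_ifs with h
  · rfl
  · exact nbhd_update J (Ne.symm h) k y

theorem earlier_update (v : V) {k k' : Fin δ} (hk : k ≤ k') (J : V × Fin δ → Fin m) (y : Fin m) :
    earlier v k (Function.update J (v, k') y) = earlier v k J := by
  refine Finset.image_congr fun l hl => ?_
  have hl' : l < k := by simpa using hl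
  exact Function.update_of_ne (fun h => (hl'.trans_le hk).ne (Prod.ext_iff.1 h).2) _ _

theorem card_crossNbhd_le (v w : V) (J : V × Fin δ → Fin m) : (crossNbhd v w J).card ≤ δ := by
  unfold crossNbhd
  split_ifs
  · simp
  · exact card_nbhd_le J w

theorem card_farRows_le (hΩ : IsDistributed d Ω) (α β : Fin p → V) (e : Fin p × Fin p)
    (J : V × Fin δ → Fin m) : (farRows α β Ω e J).card ≤ d * p * δ ^ 2 := by
  have h1 : Ω.card ≤ d * p := by
    have := Finset.card_le_mul_card_image_of_maps_to (f := Prod.fst) (s := Ω)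
      (t := Finset.univ) (fun _ _ => Finset.mem_univ _) d (fun k _ => (hΩ.2 k).1)
    simpa using this
  refine (Finset.card_biUnion_le_card_mul _ _ (δ ^ 2) fun x _ => ?_).trans
    (Nat.mul_le_mul_right _ ((Finset.card_filter_le _ _).trans h1))
  rw [Finset.card_product, pow_two]
  exact Nat.mul_le_mul (card_nbhd_le _ _) (card_nbhd_le _ _)

/-- A set of density at most `θ ^ 2` in the square has at most a fraction `θ` of heavy points. -/
theorem card_heavy_le (α β : Fin p → V) (e : Fin p × Fin p) {θ : ℝ}
    (J : V × Fin δ → Fin m) (hθm : 0 < θ * m)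
    (hfar : ((farRows α β Ω e J).card : ℝ) ≤ (θ * m) ^ 2) :
    ((heavy α β Ω e θ J).card : ℝ) ≤ θ * m := by
  have h1 : ∑ j ∈ heavy α β Ω e θ J, (farSlice α β Ω e J j).card ≤ (farRows α β Ω e J).card := by
    rw [← Finset.card_sigma]
    refine Finset.card_le_card_of_injOn (fun q => (q.1, q.2)) ?_ ?_
    · rintro ⟨j, j'⟩ hq
      exact (Finset.mem_filter.1 (Finset.mem_sigma.1 hq).2).2
    · rintro ⟨j, j'⟩ - ⟨l, l'⟩ - h
      obtain ⟨rfl, rfl⟩ := Prod.ext_iff.1 h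
      rfl
  have h2 : ((heavy α β Ω e θ J).card : ℝ) * (θ * m) ≤
      ∑ j ∈ heavy α β Ω e θ J, ((farSlice α β Ω e J j).card : ℝ) := by
    rw [← nsmul_eq_mul]
    exact Finset.card_nsmul_le_sum _ _ _ fun j hj => (Finset.mem_filter.1 hj).2.le
  have h3 : ∑ j ∈ heavy α β Ω e θ J, ((farSlice α β Ω e J j).card : ℝ) ≤ (θ * m) ^ 2 :=
    le_trans (by exact_mod_cast h1) hfar
  refine le_of_mul_le_mul_right ?_ hθm
  rw [← pow_two]
  exact h2.trans h3

variable [Fintype V]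

/-- A union bound over the entries `e` and the sources of collisions and repetitions. -/
theorem ncard_not_isSpread_le [NeZero m] (hΩ : IsDistributed d Ω) {α β : Fin p → V}
    (hα : Function.Injective α) (hβ : Function.Injective β) (hδ : 32 ≤ δ) {θ : ℝ} (hθ : 0 < θ)
    (hθ1 : θ ≤ 1) (hm : Real.sqrt (d * p) * δ ≤ θ * m) :
    (({J : V × Fin δ → Fin m | ¬ IsSpread α β Ω J}.ncard : ℕ) : ℝ) ≤
      (p : ℝ) ^ 2 * (δ + 7) *
        (2 ^ δ * θ ^ ((δ : ℝ) / 32) * (m : ℝ) ^ Fintype.card (V × Fin δ)) := by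
  set B : ℝ := 2 ^ δ * θ ^ ((δ : ℝ) / 32) * (m : ℝ) ^ Fintype.card (V × Fin δ) with hB
  set s : ℝ := (δ : ℝ) / 32 with hs
  have hδ' : (32 : ℝ) ≤ δ := by exact_mod_cast hδ
  have hm0 : (0 : ℝ) < m := by exact_mod_cast Nat.pos_of_ne_zero (NeZero.ne m)
  have hθm : 0 < θ * m := mul_pos hθ hm0
  -- The event that the edges at `v` hit their targets too often.
  let E : V → Finset (Fin δ) → (Fin δ → (V × Fin δ → Fin m) → Finset (Fin m)) →
      Set (V × Fin δ → Fin m) := fun v K T => {J | s ≤ ((hits v K T J).card : ℝ)}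
  let bad : Fin p × Fin p → Set (V × Fin δ → Fin m) := fun e =>
    E (α e.1) Finset.univ (fun _ => heavy α β Ω e θ) ∪
    E (β e.2) Finset.univ (fun _ => rowNbhd β Ω e) ∪
    E (α e.1) Finset.univ (fun _ => colNbhd α Ω e) ∪
    E (α e.1) Finset.univ (fun _ => crossNbhd (α e.1) (β e.2)) ∪
    E (β e.2) Finset.univ (fun _ => crossNbhd (β e.2) (α e.1)) ∪
    E (α e.1) Finset.univ (earlier (α e.1)) ∪
    E (β e.2) Finset.univ (earlier (β e.2)) ∪
    ⋃ k ∈ (Finset.univ : Finset (Fin δ)),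
      E (β e.2) (Finset.univ.erase k) (fun _ => lightSlice α β Ω e θ k)
  have hsub : {J : V × Fin δ → Fin m | ¬ IsSpread α β Ω J} ⊆
      ⋃ e ∈ (Finset.univ : Finset (Fin p × Fin p)), bad e := by
    intro J hJ
    by_contra hgood
    refine hJ fun e => ?_
    have hge : J ∉ bad e := fun h => hgood (by simpa using ⟨e.1, e.2, h⟩)
    simp only [bad, E, Set.mem_union, Set.mem_iUnion, Set.mem_ofPred_eq, not_or, not_exists, not_le,
      Finset.mem_univ, true_implies] at hge
    obtain ⟨⟨⟨⟨⟨⟨⟨h1, h3⟩, h4⟩, h5⟩, h6⟩, h7⟩, h8⟩, h2⟩ := hge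
    refine ⟨?_, ?_, ?_⟩
    · refine (card_collidingPairs_le hα hβ Ω e θ J (s := s) (by rw [hs]; linarith) h1.le
        (fun k => (h2 k).le) h3.le h4.le h5.le h6.le).trans (le_of_eq ?_)
      rw [hs]
      ring
    · have : (δ : ℝ) ≤ (nbhd J (α e.1)).card + (hits (α e.1) Finset.univ (earlier (α e.1)) J).card :=
        by exact_mod_cast le_card_nbhd_add_hits_earlier J (α e.1)
      rw [hs] at h7
      linarith
    · have : (δ : ℝ) ≤ (nbhd J (β e.2)).card + (hits (β e.2) Finset.univ (earlier (β e.2)) J).card :=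
        by exact_mod_cast le_card_nbhd_add_hits_earlier J (β e.2)
      rw [hs] at h8
      linarith
  have hE : ∀ v K T, (∀ k ∈ K, ∀ J, ((T k J).card : ℝ) ≤ θ * m) →
      (∀ k ∈ K, ∀ k' ∈ K, k ≤ k' → ∀ J y, T k (Function.update J (v, k') y) = T k J) →
      ((E v K T).ncard : ℝ) ≤ B := fun v K T hcard hT =>
    ncard_star_hits_le v K T hθ hθ1 hcard hT
  have hbad : ∀ e, ((bad e).ncard : ℝ) ≤ (δ + 7) * B := by
    intro e
    have hp : 1 ≤ p := e.1.pos
    have hd : 1 ≤ d := (Finset.card_pos.2 ⟨(e.1, e.1), by simp [hΩ.1 e.1]⟩).trans_le (hΩ.2 e.1).1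
    have hp' : (1 : ℝ) ≤ p := by exact_mod_cast hp
    have hd' : (1 : ℝ) ≤ d := by exact_mod_cast hd
    have hδm : (δ : ℝ) ≤ θ * m := by
      refine le_trans ?_ hm
      have : 1 ≤ Real.sqrt (d * p) := Real.one_le_sqrt.2 (by nlinarith)
      nlinarith
    have hmin : ((min d p * δ : ℕ) : ℝ) ≤ θ * m := by
      refine le_trans ?_ hm
      push_cast
      gcongr
      refine Real.le_sqrt_of_sq_le ?_
      rw [pow_two]
      exact mul_le_mul (min_le_left _ _) (min_le_right _ _) (by positivity) (by positivity)
    have hsq : ((d * p * δ ^ 2 : ℕ) : ℝ) ≤ (θ * m) ^ 2 := by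
      have := pow_le_pow_left₀ (by positivity) hm 2
      rw [mul_pow, Real.sq_sqrt (by positivity)] at this
      exact_mod_cast this
    have hnat : ∀ {n N : ℕ}, n ≤ N → (N : ℝ) ≤ θ * m → (n : ℝ) ≤ θ * m := fun h h' =>
      (Nat.cast_le.2 h).trans h'
    have e1 := hE (α e.1) Finset.univ (fun _ => heavy α β Ω e θ)
      (fun k _ J => card_heavy_le α β e J hθm
        ((Nat.cast_le.2 (card_farRows_le hΩ α β e J)).trans hsq))
      (fun k _ k' _ _ J y => heavy_update α β Ω e θ J (Or.inl rfl) k' y)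
    have e2 : ∀ k, ((E (β e.2) (Finset.univ.erase k)
        (fun _ => lightSlice α β Ω e θ k)).ncard : ℝ) ≤ B := by
      refine fun k => hE _ _ _ (fun _ _ J => ?_)
        (fun _ _ k' hk' _ J y => lightSlice_update α β Ω e θ (Finset.ne_of_mem_erase hk') J y)
      unfold lightSlice
      split_ifs with h
      · simpa using hθm.le
      · simpa [heavy] using h
    have e3 := hE (β e.2) Finset.univ (fun _ => rowNbhd β Ω e)
      (fun _ _ J => hnat (card_rowNbhd_le hΩ β e J) hmin)
      (fun _ _ k' _ _ J y => rowNbhd_update hβ Ω e J k' y)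
    have e4 := hE (α e.1) Finset.univ (fun _ => colNbhd α Ω e)
      (fun _ _ J => hnat (card_colNbhd_le hΩ α e J) hmin)
      (fun _ _ k' _ _ J y => colNbhd_update hα Ω e J k' y)
    have e5 := hE (α e.1) Finset.univ (fun _ => crossNbhd (α e.1) (β e.2))
      (fun _ _ J => hnat (card_crossNbhd_le _ _ J) hδm)
      (fun _ _ k' _ _ J y => crossNbhd_update _ _ J k' y)
    have e6 := hE (β e.2) Finset.univ (fun _ => crossNbhd (β e.2) (α e.1))
      (fun _ _ J => hnat (card_crossNbhd_le _ _ J) hδm)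
      (fun _ _ k' _ _ J y => crossNbhd_update _ _ J k' y)
    have e7 : ∀ v, ((E v Finset.univ (earlier v)).ncard : ℝ) ≤ B := fun v =>
      hE v Finset.univ (earlier v) (fun k _ J => hnat (card_earlier_le v k J) hδm)
        (fun _ _ _ _ hk J y => earlier_update v hk J y)
    have hU : ((⋃ k ∈ (Finset.univ : Finset (Fin δ)), E (β e.2) (Finset.univ.erase k)
        (fun _ => lightSlice α β Ω e θ k)).ncard : ℝ) ≤ δ * B := by
      refine (Nat.cast_le.2 (Finset.set_ncard_biUnion_le _ _)).trans ?_
      rw [Nat.cast_sum]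
      refine (Finset.sum_le_sum fun k _ => e2 k).trans (le_of_eq ?_)
      simp
    have hadd : ∀ (S T : Set (V × Fin δ → Fin m)) {x y : ℝ}, (S.ncard : ℝ) ≤ x →
        (T.ncard : ℝ) ≤ y → ((S ∪ T).ncard : ℝ) ≤ x + y := fun S T x y hx hy =>
      (Nat.cast_le.2 (Set.ncard_union_le S T)).trans (by push_cast; linarith)
    refine (hadd _ _ (hadd _ _ (hadd _ _ (hadd _ _ (hadd _ _ (hadd _ _ (hadd _ _ e1 e3) e4) e5) e6)
      (e7 _)) (e7 _)) hU).trans (le_of_eq ?_)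
    ring
  refine (Nat.cast_le.2 ((Set.ncard_le_ncard hsub (Set.toFinite _)).trans
    (Finset.set_ncard_biUnion_le _ _))).trans ?_
  rw [Nat.cast_sum]
  refine (Finset.sum_le_sum fun e _ => hbad e).trans (le_of_eq ?_)
  simp only [Finset.sum_const, Finset.card_univ, Fintype.card_prod, Fintype.card_fin, nsmul_eq_mul]
  push_cast
  ring

/-- A union bound over pairs of edges. -/
theorem ncard_not_injective_le [NeZero m] :
    (({J : V × Fin δ → Fin m | ¬ Function.Injective J}.ncard : ℕ) : ℝ) * m ≤
      2 * (Fintype.card (V × Fin δ) : ℝ) ^ 2 * (m : ℝ) ^ Fintype.card (V × Fin δ) := by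
  have hm0 : 0 < m := Nat.pos_of_ne_zero (NeZero.ne m)
  have hm : (0 : ℝ) < m := by exact_mod_cast hm0
  let E : (V × Fin δ) × (V × Fin δ) → Set (V × Fin δ → Fin m) := fun q =>
    {J | q.1 ≠ q.2 ∧ J q.1 = J q.2}
  have hsub : {J : V × Fin δ → Fin m | ¬ Function.Injective J} ⊆
      ⋃ q ∈ (Finset.univ : Finset ((V × Fin δ) × (V × Fin δ))), E q := by
    intro J hJ
    obtain ⟨r, r', h, hne⟩ := Function.not_injective_iff.1 hJ
    exact Set.mem_biUnion (Finset.mem_coe.2 (Finset.mem_univ (r, r'))) ⟨hne, h⟩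
  have hE : ∀ q, ((E q).ncard : ℝ) ≤ 2 * (m : ℝ)⁻¹ * (m : ℝ) ^ Fintype.card (V × Fin δ) := by
    rintro ⟨r, r'⟩
    by_cases hne : r = r'
    · have : E (r, r') = ∅ := by
        ext J
        simp [E, hne]
      rw [this]
      simp only [Set.ncard_empty, Nat.cast_zero]
      positivity
    · have h := ncard_hits_le (s := 1) {r} (fun _ => 0) (fun _ J => ({J r'} : Finset (Fin m)))
        (inv_pos.2 hm) (inv_le_one_of_one_le₀ (by exact_mod_cast hm0))
        (by simp [hm.ne']) (by
          intro x _ x' hx' _ J y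
          obtain rfl := Finset.mem_singleton.1 hx'
          rw [Function.update_of_ne (Ne.symm hne)])
      rw [Finset.card_singleton, pow_one, Real.rpow_one, Fintype.card_fin] at h
      refine le_trans (Nat.cast_le.2 (Set.ncard_le_ncard ?_ (Set.toFinite _))) h
      rintro J ⟨-, hJ⟩
      have hJ' : J r = J r' := hJ
      simp [Finset.filter_singleton, hJ']
  have h := (Nat.cast_le (α := ℝ)).2 ((Set.ncard_le_ncard hsub (Set.toFinite _)).trans
    (Finset.set_ncard_biUnion_le _ _))
  rw [Nat.cast_sum] at h
  have h2 := h.trans (Finset.sum_le_sum fun q _ => hE q)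
  simp only [Finset.sum_const, Finset.card_univ, nsmul_eq_mul] at h2
  rw [Fintype.card_prod (V × Fin δ) (V × Fin δ)] at h2
  push_cast at h2
  refine (mul_le_mul_of_nonneg_right h2 hm.le).trans (le_of_eq ?_)
  field_simp

end Probability

theorem IsDistributed.one_le {p d : ℕ} {Ω : Finset (Fin p × Fin p)} (hΩ : IsDistributed d Ω)
    (hp : 2 ≤ p) : 1 ≤ d := by
  have i : Fin p := ⟨0, by omega⟩
  exact (Finset.card_pos.2 ⟨(i, i), by simp [hΩ.1 i]⟩).trans_le (hΩ.2 i).1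

/-- If `δ ≥ 32`, the union bound over collision sources wins; if `δ < 32`, then `p` is bounded and
already a single coincidence of endpoints is unlikely. -/
theorem exists_ncard_not_isSpread_lt (a b : ℝ) (ha : 0 < a) :
    ∃ C : ℝ, 0 < C ∧ ∀ p d m δ : ℕ, 2 ≤ p →
      C * Real.sqrt ((d : ℝ) * (p : ℝ)) * Real.log (p : ℝ) ≤ (m : ℝ) →
      a * Real.log (p : ℝ) ≤ (δ : ℝ) → (δ : ℝ) ≤ b * Real.log (p : ℝ) →
      ∀ Ω : Finset (Fin p × Fin p), IsDistributed d Ω →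
        0 < m ∧ 0 < δ ∧
        ∀ (V : Type) [Fintype V] (α β : Fin p → V),
          Function.Injective α → Function.Injective β → Fintype.card V ≤ 2 * p →
          (({J : V × Fin δ → Fin m | ¬ IsSpread α β Ω J}.ncard : ℕ) : ℝ) * p <
            (m : ℝ) ^ Fintype.card (V × Fin δ) := by
  -- The choice of `θ` makes `4 ^ δ * θ ^ (δ / 32)` at most `exp (-8 * δ / a) ≤ p ^ (-8)`.
  set η : ℝ := Real.exp (-8 / a) / 4 with hη
  have hη0 : 0 < η := by positivity
  have hη1 : η ≤ 1 := by
    have : Real.exp (-8 / a) ≤ 1 := Real.exp_le_one_iff.2 (div_nonpos_of_nonpos_of_nonneg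
      (by norm_num) ha.le)
    rw [hη]
    linarith
  set θ : ℝ := η ^ 32 with hθ
  have hθ0 : 0 < θ := by positivity
  have hθ1 : θ ≤ 1 := pow_le_one₀ hη0.le hη1
  set P : ℝ := Real.exp (32 / a) with hP
  have hP0 : 0 < P := Real.exp_pos _
  have hb0 : 0 ≤ |b| / θ := by positivity
  refine ⟨|b| / θ + 20480 * P ^ 3, by positivity, fun p d m δ hp hm hδa hδb Ω hΩ => ?_⟩
  have hd := hΩ.one_le hp
  have hp' : (2 : ℝ) ≤ p := by exact_mod_cast hp
  have hd' : (1 : ℝ) ≤ d := by exact_mod_cast hd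
  have hlog : 1 / 2 < Real.log p := by
    have := Real.log_two_gt_d9
    have := Real.log_le_log two_pos hp'
    linarith
  have hsqrt : 1 ≤ Real.sqrt (d * p) := Real.one_le_sqrt.2 (by nlinarith)
  have hsl : 1 / 2 < Real.sqrt (d * p) * Real.log p := by nlinarith
  have hmP : 10240 * P ^ 3 < m := by
    have h1 : 20480 * P ^ 3 * (1 / 2) < 20480 * P ^ 3 * (Real.sqrt (d * p) * Real.log p) :=
      mul_lt_mul_of_pos_left hsl (by positivity)
    have h2 : 0 ≤ |b| / θ * (Real.sqrt (d * p) * Real.log p) :=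
      mul_nonneg hb0 (by linarith)
    nlinarith
  have hmb : Real.sqrt (d * p) * δ ≤ θ * m := by
    have h1 : |b| / θ * (Real.sqrt (d * p) * Real.log p) ≤ m := by
      have h2 : 0 ≤ 20480 * P ^ 3 * (Real.sqrt (d * p) * Real.log p) :=
        mul_nonneg (by positivity) (by linarith)
      nlinarith
    have h3 : (δ : ℝ) ≤ |b| * Real.log p :=
      hδb.trans (mul_le_mul_of_nonneg_right (le_abs_self b) (by linarith))
    calc Real.sqrt (d * p) * δ ≤ Real.sqrt (d * p) * (|b| * Real.log p) := by gcongr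
      _ = θ * (|b| / θ * (Real.sqrt (d * p) * Real.log p)) := by field_simp
      _ ≤ θ * m := by gcongr
  have hm0 : (0 : ℝ) < m := lt_trans (by positivity) hmP
  have hmN : 0 < m := by exact_mod_cast hm0
  have hδ0 : (0 : ℝ) < δ := lt_of_lt_of_le (mul_pos ha (by linarith)) hδa
  refine ⟨hmN, by exact_mod_cast hδ0, fun V _ α β hα hβ hV => ?_⟩
  classical
  have : NeZero m := ⟨hmN.ne'⟩
  have hN : (0 : ℝ) < (m : ℝ) ^ Fintype.card (V × Fin δ) := by positivity
  set N : ℝ := (m : ℝ) ^ Fintype.card (V × Fin δ) with hNdef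
  rcases le_or_gt 32 δ with hδ | hδ
  · have h := ncard_not_isSpread_le hΩ hα hβ hδ hθ0 hθ1 hmb
    have h1 : θ ^ ((δ : ℝ) / 32) = η ^ δ := by
      rw [hθ, ← Real.rpow_natCast η 32, ← Real.rpow_mul hη0.le, ← Real.rpow_natCast η δ]
      congr 1
      push_cast
      ring
    have h2 : (δ : ℝ) + 7 ≤ 7 * 2 ^ δ := by
      have : ((δ + 1 : ℕ) : ℝ) ≤ ((2 ^ δ : ℕ) : ℝ) := Nat.cast_le.2 Nat.lt_two_pow_self
      push_cast at this
      linarith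
    have h3 : (2 : ℝ) ^ δ * (2 ^ δ * η ^ δ) ≤ ((p : ℝ) ^ 8)⁻¹ := by
      rw [← mul_pow, ← mul_pow, hη]
      have : (2 : ℝ) * (2 * (Real.exp (-8 / a) / 4)) = Real.exp (-8 / a) := by ring
      rw [this, ← Real.exp_nat_mul]
      have h4 : ((p : ℝ) ^ 8)⁻¹ = Real.exp (-(8 * Real.log p)) := by
        rw [Real.exp_neg, mul_comm, Real.exp_mul, Real.exp_log (by linarith)]
        norm_num
      rw [h4, Real.exp_le_exp]
      have h5 : Real.log p ≤ δ / a := by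
        rw [le_div_iff₀ ha]
        linarith
      calc (δ : ℝ) * (-8 / a) = -(8 * (δ / a)) := by ring
        _ ≤ _ := by linarith
    have h5 : (p : ℝ) ^ 2 * (δ + 7) * (2 ^ δ * θ ^ ((δ : ℝ) / 32) * N) * p < N := by
      calc (p : ℝ) ^ 2 * (δ + 7) * (2 ^ δ * θ ^ ((δ : ℝ) / 32) * N) * p
          ≤ (p : ℝ) ^ 2 * (7 * 2 ^ δ) * (2 ^ δ * η ^ δ * N) * p := by
            rw [h1]
            gcongr
        _ = 7 * (p : ℝ) ^ 3 * N * (2 ^ δ * (2 ^ δ * η ^ δ)) := by ring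
        _ ≤ 7 * (p : ℝ) ^ 3 * N * ((p : ℝ) ^ 8)⁻¹ := by gcongr
        _ = 7 / (p : ℝ) ^ 5 * N := by
            field_simp
        _ < 1 * N := by
            refine mul_lt_mul_of_pos_right ?_ hN
            rw [div_lt_one (by positivity)]
            have : (2 : ℝ) ^ 5 ≤ (p : ℝ) ^ 5 := by gcongr
            linarith
        _ = N := one_mul N
    exact (mul_le_mul_of_nonneg_right h (by positivity)).trans_lt h5
  · have hδ' : (δ : ℝ) ≤ 32 := by exact_mod_cast hδ.le
    have hpP : (p : ℝ) ≤ P := by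
      rw [hP, ← Real.log_le_iff_le_exp (by linarith), le_div_iff₀ ha]
      linarith
    have hsub : {J : V × Fin δ → Fin m | ¬ IsSpread α β Ω J} ⊆
        {J | ¬ Function.Injective J} := fun J hJ hinj => hJ (isSpread_of_injective hα hβ Ω hinj)
    have h1 := mul_le_mul_of_nonneg_right
      ((Nat.cast_le (α := ℝ)).2 (Set.ncard_le_ncard hsub (Set.toFinite _))) hm0.le
    have h2 := h1.trans ncard_not_injective_le
    have hcard : (Fintype.card (V × Fin δ) : ℝ) ≤ 64 * P := by
      rw [Fintype.card_prod, Fintype.card_fin]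
      have hV' : (Fintype.card V : ℝ) ≤ 2 * p := by exact_mod_cast hV
      push_cast
      calc (Fintype.card V : ℝ) * δ ≤ (2 * P) * 32 := by gcongr; linarith
        _ = 64 * P := by ring
    refine lt_of_mul_lt_mul_right ?_ hm0.le
    calc _ = (({J : V × Fin δ → Fin m | ¬ IsSpread α β Ω J}.ncard : ℕ) : ℝ) * m * p := by ring
      _ ≤ 2 * (Fintype.card (V × Fin δ) : ℝ) ^ 2 * N * p := by gcongr
      _ ≤ 2 * (64 * P) ^ 2 * N * P := by gcongr
      _ = N * (8192 * P ^ 3) := by ring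
      _ < N * m := by
        refine mul_lt_mul_of_pos_left (lt_of_le_of_lt ?_ hmP) hN
        have : 0 < P ^ 3 := by positivity
        linarith

/-! ### Uniform measures and counting -/

/-- A probability measure giving all points of a finite space the same mass is the normalized
counting measure; here the space is parametrized by `f`, and `S` contains the exceptional
parameters. -/
theorem one_sub_inv_lt_measureReal {α W : Type*} [Fintype α] [MeasurableSpace α]
    [MeasurableSingletonClass α] [Fintype W] (μ : Measure α) [IsProbabilityMeasure μ] {q : ℝ}
    (hμ : ∀ x, μ.real {x} = q) (f : W ≃ α) {G : Set α} {S : Set W}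
    (hS : ∀ J, J ∉ S → f J ∈ G) {p : ℝ} (hp : 0 < p) (h : (S.ncard : ℝ) * p < Fintype.card W) :
    1 - p ^ (-1 : ℝ) < μ.real G := by
  classical
  have hsum : ∀ s : Finset α, μ.real s = s.card * q := by
    intro s
    rw [← sum_measureReal_singleton, Finset.sum_congr rfl fun x _ => hμ x, Finset.sum_const,
      nsmul_eq_mul]
  have hq : (Fintype.card W : ℝ) * q = 1 := by
    rw [Fintype.card_congr f, ← Finset.card_univ, ← hsum, Finset.coe_univ, probReal_univ]
  have hq0 : 0 < q := by
    by_contra! hneg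
    nlinarith [(Nat.cast_nonneg (Fintype.card W) : (0 : ℝ) ≤ _)]
  have hbad : μ.real Gᶜ ≤ S.ncard * q := by
    rw [← Set.coe_toFinset Gᶜ, hsum, ← Set.ncard_eq_toFinset_card']
    have hsub : Gᶜ ⊆ f '' S := by
      intro x hx
      refine ⟨f.symm x, ?_, f.apply_symm_apply x⟩
      by_contra hn
      exact hx (by simpa using hS _ hn)
    have := (Set.ncard_le_ncard hsub (Set.toFinite _)).trans (Set.ncard_image_le (Set.toFinite _))
    gcongr
  have hlt : S.ncard * q < p⁻¹ := by
    rw [← one_div, lt_div_iff₀ hp]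
    calc S.ncard * q * p = S.ncard * p * q := by ring
      _ < Fintype.card W * q := mul_lt_mul_of_pos_right h hq0
      _ = 1 := hq
  have hcompl := probReal_compl_eq_one_sub (μ := μ) (s := G) (Set.toFinite G).measurableSet
  rw [Real.rpow_neg_one]
  linarith

theorem isProbabilityMeasure_graphLaw {p m δ : ℕ} (hm : 0 < m) :
    IsProbabilityMeasure (graphLaw p m δ) := by
  have : Nonempty (Fin m) := ⟨⟨0, hm⟩⟩
  have : IsProbabilityMeasure (ProbabilityTheory.uniformOn (Set.univ : Set (Fin m))) :=
    ProbabilityTheory.isProbabilityMeasure_uniformOn Set.finite_univ Set.univ_nonempty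
  unfold graphLaw
  infer_instance

theorem graphLaw_real_singleton {p m δ : ℕ} (hm : 0 < m) (G : EdgeChoice p m δ) :
    (graphLaw p m δ).real {G} = (((m : ℝ)⁻¹) ^ δ) ^ p := by
  have : Nonempty (Fin m) := ⟨⟨0, hm⟩⟩
  have : IsProbabilityMeasure (ProbabilityTheory.uniformOn (Set.univ : Set (Fin m))) :=
    ProbabilityTheory.isProbabilityMeasure_uniformOn Set.finite_univ Set.univ_nonempty
  have h1 : ∀ x : Fin m, ProbabilityTheory.uniformOn (Set.univ : Set (Fin m)) {x} =
      (m : ENNReal)⁻¹ := by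
    intro x
    rw [ProbabilityTheory.uniformOn_univ, Measure.count_singleton, Fintype.card_fin, one_div]
  rw [Measure.real, graphLaw, Measure.pi_singleton]
  simp [Measure.pi_singleton, h1]

end Sketch

end

theorem theorem1 (a b : ℝ) (ha : 0 < a) :
    ∃ C : ℝ, 0 < C ∧ ∃ c : ℝ, 0 < c ∧
      ∀ p d m δ : ℕ, 2 ≤ p →
        C * Real.sqrt ((d : ℝ) * (p : ℝ)) * Real.log (p : ℝ) ≤ (m : ℝ) →
        a * Real.log (p : ℝ) ≤ (δ : ℝ) → (δ : ℝ) ≤ b * Real.log (p : ℝ) →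
        ∀ X : Matrix (Fin p) (Fin p) ℝ, Sketch.IsDistributedSparse d X →
          (1 - (p : ℝ) ^ (-c) <
              ((Sketch.graphLaw p m δ).prod (Sketch.graphLaw p m δ)).real
                {J | Sketch.Recovers (Sketch.adjacency J.1) (Sketch.adjacency J.2) X} ∧
            1 - (p : ℝ) ^ (-c) <
              (Sketch.graphLaw p m δ).real
                {J | Sketch.Recovers (Sketch.adjacency J) (Sketch.adjacency J) X}) ∧
          (1 - (p : ℝ) ^ (-c) <
              ((Sketch.graphLaw p m δ).prod (Sketch.graphLaw p m δ)).real
                {J | Sketch.Recovers (Sketch.multiAdjacency J.1) (Sketch.multiAdjacency J.2) X} ∧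
            1 - (p : ℝ) ^ (-c) <
              (Sketch.graphLaw p m δ).real
                {J | Sketch.Recovers (Sketch.multiAdjacency J) (Sketch.multiAdjacency J) X}) := by
  obtain ⟨C, hC, h⟩ := Sketch.exists_ncard_not_isSpread_lt a b ha
  refine ⟨C, hC, 1, one_pos, fun p d m δ hp hm hδa hδb X ⟨Ω, hΩ, hX⟩ => ?_⟩
  obtain ⟨hm0, hδ0, hcount⟩ := h p d m δ hp hm hδa hδb Ω hΩ
  have hp0 : (0 : ℝ) < p := by exact_mod_cast (by omega : 0 < p)
  have := Sketch.isProbabilityMeasure_graphLaw (p := p) (δ := δ) hm0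
  have hsingle := Sketch.graphLaw_real_singleton (p := p) (δ := δ) hm0
  have hpair : ∀ J : Sketch.EdgeChoice p m δ × Sketch.EdgeChoice p m δ,
      ((Sketch.graphLaw p m δ).prod (Sketch.graphLaw p m δ)).real {J} =
        (((m : ℝ)⁻¹) ^ δ) ^ p * (((m : ℝ)⁻¹) ^ δ) ^ p := by
    rintro ⟨G, H⟩
    rw [← Set.singleton_prod_singleton, measureReal_prod_prod, hsingle, hsingle]
  -- A pair of graphs on `[p]` is a graph on two disjoint copies of `[p]`.
  let pairEquiv : ((Fin p ⊕ Fin p) × Fin δ → Fin m) ≃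
      Sketch.EdgeChoice p m δ × Sketch.EdgeChoice p m δ :=
    (Equiv.curry _ _ _).trans (Equiv.sumArrowEquivProdArrow _ _ _)
  have hcount2 := hcount (Fin p ⊕ Fin p) Sum.inl Sum.inr Sum.inl_injective Sum.inr_injective
    (by simp [two_mul])
  have hcount1 := hcount (Fin p) id id Function.injective_id Function.injective_id
    (by simp only [Fintype.card_fin]; omega)
  have hrec2 : ∀ J : (Fin p ⊕ Fin p) × Fin δ → Fin m,
      J ∉ {J | ¬ Sketch.IsSpread Sum.inl Sum.inr Ω J} → _ := fun J hJ =>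
    (not_not.1 hJ).recovers_adjacency hδ0 hX
  have hrec1 : ∀ J : Fin p × Fin δ → Fin m,
      J ∉ {J | ¬ Sketch.IsSpread id id Ω J} → _ := fun J hJ =>
    (not_not.1 hJ).recovers_adjacency hδ0 hX
  exact ⟨⟨Sketch.one_sub_inv_lt_measureReal _ hpair pairEquiv (fun J hJ => (hrec2 J hJ).1) hp0
        (by simpa using hcount2),
      Sketch.one_sub_inv_lt_measureReal _ hsingle (Equiv.curry _ _ _)
        (fun J hJ => (hrec1 J hJ).1) hp0 (by simpa using hcount1)⟩,
    ⟨Sketch.one_sub_inv_lt_measureReal _ hpair pairEquiv (fun J hJ => (hrec2 J hJ).2) hp0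
        (by simpa using hcount2),
      Sketch.one_sub_inv_lt_measureReal _ hsingle (Equiv.curry _ _ _)
        (fun J hJ => (hrec1 J hJ).2) hp0 (by simpa using hcount1)⟩⟩
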